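/- Graphs are loopless multigraphs (parallel edges are allowed) with a finite, nonempty vertex set. For a graph $G$ and $S\subseteq V(G)$, let $G\setminus S$ be the graph obtained by deleting the vertices of $S$, and let $\omega(G\setminus S)$ be its number of connected components (so $\omega=0$ when $S=V(G)$). A closed walk is a sequence $v_0e_1v_1\dots e_kv_k$ with $k\ge 0$ and $v_k=v_0$, in which each $e_i$ is an edge of $G$ with ends $v_{i-1}$ and $v_i$, and vertices and edges may be repeated. For $k\ge 1$ it meets a vertex $v$ exactly $|\{i: 1\le i\le k,\ v_i=v\}|$ times, and for $k=0$ it meets $v_0$ once and no other vertex. It is spanning if every vertex of $G$ occurs in it. For a positive integer-valued function $f$ on $V(G)$, an $f$-walk is a spanning closed walk that meets each vertex $v$ at most $f(v)$ times; for a positive integer $n$, an $n$-walk is an $f$-walk with $f$ constantly equal to $n$. For a real number $t>0$, $G$ is $t$-tough if $\omega(G\setminus S)\le \max\{1,\tfrac1t|S|\}$ for all $S\subseteq V(G)$. A matching is a set of edges no two of which share an end. **Theorem.** Let $G$ be a graph. (1) Let $f$ be a positive integer-valued function on $V(G)$. If $$\omega(G\setminus S)\le \sum_{v\in S}\bigl(f(v)-1\bigr)+1\qquad\text{for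 all } S\subseteq V(G),$$ then for every matching $M$ of $G$ there is an $f$-walk in $G$ that passes through every edge of $M$. (2) Let $n\ge 2$ be an integer. If $G$ is $\frac{1}{n-1}$-tough, then $G$ has an $n$-walk. -/

import Mathlib

/-!
Loopless multigraphs are Mathlib's `Graph α β` with `Graph.Loopless`; parallel edges are allowed,
and deletion of vertices is `Graph.deleteVerts`.
-/

namespace Graph

variable {α β : Type*}

/-- The number of connected components: the number of classes of the equivalence relation on the
vertex set that is generated by adjacency. -/
noncomputable def numComponents (G : Graph α β) : ℕ :=
  Nat.card (Quot fun x y : G.vertexSet => G.Adj x y)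

/-- A walk `v₀ e₁ v₁ … eₖ vₖ` in a multigraph; vertices and edges may be repeated. -/
inductive Walk (G : Graph α β) : α → α → Type _
  | nil {x : α} (hx : x ∈ G.vertexSet) : Walk G x x
  | cons {x y z : α} (e : β) (h : G.IsLink e x y) (p : Walk G y z) : Walk G x z

namespace Walk

variable {G : Graph α β}

/-- The list of vertices `v₀, …, vₖ` of a walk. -/
def support : {x y : α} → G.Walk x y → List α
  | x, _, nil _ => [x]
  | x, _, cons _ _ p => x :: p.support

/-- The list of edges `e₁, …, eₖ` of a walk. -/
def edges : {x y : α} → G.Walk x y → List β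
  | _, _, nil _ => []
  | _, _, cons e _ p => e :: p.edges

/-- The vertices `v₁, …, vₖ` met by a closed walk `v₀ e₁ v₁ … eₖ vₖ = v₀` with `k ≥ 1`, in cyclic
order, so that the coinciding first and last vertices count only once. The walk of length `0`
meets its only vertex once. (To be used for closed walks.) -/
def cyclicSupport : {x y : α} → G.Walk x y → List α
  | x, _, nil _ => [x]
  | _, _, cons _ _ p => p.support

open Classical in
/-- The number of times that a closed walk meets the vertex `v`. -/
noncomputable def meetCount {x : α} (w : G.Walk x x) (v : α) : ℕ :=
  w.cyclicSupport.count v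

/-- An `f`-walk: a spanning closed walk that meets each vertex `v` at most `f v` times. -/
structure IsFWalk {x : α} (w : G.Walk x x) (f : α → ℕ) : Prop where
  spanning : ∀ v ∈ G.vertexSet, v ∈ w.support
  meetCount_le : ∀ v ∈ G.vertexSet, w.meetCount v ≤ f v

end Walk

/-- A matching: a set of edges of `G` no two of which share an end. (To be used for loopless
graphs.) -/
structure IsEdgeMatching (G : Graph α β) (M : Set β) : Prop where
  subset : M ⊆ G.edgeSet
  eq_of_inc : ∀ e ∈ M, ∀ e' ∈ M, ∀ v, G.Inc e v → G.Inc e' v → e = e'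

/-- A graph with finitely many vertices is `t`-tough, for a positive real `t`, if
`ω(G ∖ S) ≤ max {1, |S| / t}` for every set `S` of vertices. -/
def IsTough (G : Graph α β) (t : ℝ) : Prop :=
  ∀ S : Finset α, (S : Set α) ⊆ G.vertexSet →
    ((G.deleteVerts (S : Set α)).numComponents : ℝ) ≤ max 1 (1 / t * (S.card : ℝ))

end Graph

/-! The walk is an Eulerian tour of a connected even multigraph `T + J`, with `T` a spanning tree
containing the matching and `J` a parity correction.

The tree (`ComponentBound.exists_isTree`) has degrees at most `f + 1`. Take a connected `T` between
`M` and `H` of least total excess over `F = f + 1`, then with fewest edges. If some degree is still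
too large, take a smallest barrier `D`: its vertices reach their bounds, and any other vertex can be
brought below its bound by changes inside its own component of `T ∖ D`. An edge of `H` joining two
of these components would allow an exchange that lowers the excess or shrinks `D`. So `T ∖ D` has no
more components than `H ∖ D`, and counting edges of the tree contradicts the component bound.

Put `h = 2f - deg T`, so `h ≥ f - 1`. Replace each vertex `v` by a clique of `h v` copies. The
component bound and parity give Tutte's condition, and a perfect matching of the blow-up projects to
`J`, with degrees at most `h` and of the parity of `h`. Hence `T + J` has even degrees at most `2f`,
and its Eulerian tour meets `v` at most `f v` times. Toughness implies the component bound for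
constant `f`. -/

namespace SimpleGraph

universe u
variable {V : Type u}

/-! ### Local rearrangements and the exchange step. -/

section

/-- The edges of `T` with both ends in `s`, as a graph on the whole vertex type. -/
def restrictTo (T : SimpleGraph V) (s : Set V) : SimpleGraph V where
  Adj a b := T.Adj a b ∧ a ∈ s ∧ b ∈ s
  symm := ⟨fun _ _ h => ⟨h.1.symm, h.2.2, h.2.1⟩⟩
  loopless := ⟨fun _ h => h.1.ne rfl⟩

theorem restrictTo_mono {T T' : SimpleGraph V} {s s' : Set V} (h : T ≤ T') (hs : s ⊆ s') :
    T.restrictTo s ≤ T'.restrictTo s' :=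
  fun _ _ hab => ⟨h hab.1, hs hab.2.1, hs hab.2.2⟩

theorem restrictTo_le (T : SimpleGraph V) (s : Set V) : T.restrictTo s ≤ T := fun _ _ h => h.1

theorem Reachable.of_forall_adj {A B : SimpleGraph V} (h : ∀ a b, A.Adj a b → B.Reachable a b)
    {a b : V} (hab : A.Reachable a b) : B.Reachable a b := by
  obtain ⟨p⟩ := hab
  induction p with
  | nil => exact Reachable.refl _
  | cons hadj _ ih => exact (h _ _ hadj).trans ih

theorem Reachable.mem_of_restrictTo {T : SimpleGraph V} {s : Set V} {a b : V}
    (h : (T.restrictTo s).Reachable a b) (ha : a ∈ s) : b ∈ s := by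
  obtain ⟨p⟩ := h
  induction p with
  | nil => exact ha
  | cons hadj _ ih => exact ih hadj.2.2

theorem Reachable.induce_of_restrictTo {T : SimpleGraph V} {s : Set V} {a b : V}
    (h : (T.restrictTo s).Reachable a b) (ha : a ∈ s) (hb : b ∈ s) :
    (T.induce s).Reachable ⟨a, ha⟩ ⟨b, hb⟩ := by
  obtain ⟨p⟩ := h
  induction p with
  | nil => exact Reachable.refl _
  | @cons u v w hadj _ ih =>
    have : (T.induce s).Adj ⟨u, ha⟩ ⟨v, hadj.2.2⟩ := hadj.1
    exact this.reachable.trans (ih hadj.2.2 hb)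

theorem Walk.reachable_restrictTo_deleteEdges {T : SimpleGraph V} {K : Set V} {E : Set (Sym2 V)}
    {a b : V} (p : T.Walk a b) (hK : ∀ v ∈ p.support, v ∈ K) (hE : ∀ e ∈ p.edges, e ∉ E) :
    ((T.deleteEdges E).restrictTo K).Reachable a b := by
  induction p with
  | nil => exact Reachable.refl _
  | @cons u v w hadj p ih =>
    have h1 : ((T.deleteEdges E).restrictTo K).Adj u v := by
      refine ⟨deleteEdges_adj.2 ⟨hadj, hE _ (by simp)⟩, hK _ (by simp), hK _ (by simp)⟩
    exact h1.reachable.trans (ih (fun v hv => hK v (by simp [hv])) (fun e he => hE e (by simp [he])))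

/-- `T'` arises from `T` by changing edges inside `K` only, in such a way that vertices of `K` that
were joined by an edge inside `K` are still connected inside `K`. -/
structure IsRearrangement (T T' : SimpleGraph V) (K : Set V) : Prop where
  adj_iff : ∀ a b, ¬(a ∈ K ∧ b ∈ K) → (T'.Adj a b ↔ T.Adj a b)
  reachable : ∀ a b, a ∈ K → b ∈ K → T.Adj a b → (T'.restrictTo K).Reachable a b

namespace IsRearrangement

variable {T T' T'' : SimpleGraph V} {K X Y : Set V}

theorem refl (T : SimpleGraph V) (K : Set V) : IsRearrangement T T K :=
  ⟨fun _ _ _ => Iff.rfl, fun a b ha hb h =>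
    Adj.reachable (G := T.restrictTo K) (⟨h, ha, hb⟩ : (T.restrictTo K).Adj a b)⟩

theorem mono (h : IsRearrangement T T' X) (hX : X ⊆ K) : IsRearrangement T T' K := by
  refine ⟨fun a b hab => h.adj_iff a b fun hab' => hab ⟨hX hab'.1, hX hab'.2⟩,
    fun a b ha hb hadj => ?_⟩
  by_cases hab : a ∈ X ∧ b ∈ X
  · exact (h.reachable a b hab.1 hab.2 hadj).mono (restrictTo_mono le_rfl hX)
  · exact Adj.reachable (G := T'.restrictTo K)
      (⟨(h.adj_iff a b hab).2 hadj, ha, hb⟩ : (T'.restrictTo K).Adj a b)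

theorem reachable_restrictTo (h : IsRearrangement T T' K) {a b : V}
    (hab : (T.restrictTo K).Reachable a b) : (T'.restrictTo K).Reachable a b :=
  hab.of_forall_adj fun a b (h' : (T.restrictTo K).Adj a b) => h.reachable a b h'.2.1 h'.2.2 h'.1

theorem trans (h : IsRearrangement T T' K) (h' : IsRearrangement T' T'' K) :
    IsRearrangement T T'' K :=
  ⟨fun a b hab => (h'.adj_iff a b hab).trans (h.adj_iff a b hab),
    fun a b ha hb hadj => h'.reachable_restrictTo (h.reachable a b ha hb hadj)⟩

theorem connected (h : IsRearrangement T T' K) (hT : T.Connected) : T'.Connected := by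
  have := hT.nonempty
  refine ⟨fun a b => (hT.preconnected a b).of_forall_adj fun a b hab => ?_⟩
  by_cases hK : a ∈ K ∧ b ∈ K
  · exact (h.reachable a b hK.1 hK.2 hab).mono (restrictTo_le _ _)
  · exact ((h.adj_iff a b hK).2 hab).reachable

/-- An edge with an end outside `X` is never used by the connections inside `X`. -/
theorem deleteEdge (h : IsRearrangement T T' X) {z z' : V} (hz : z ∉ X) :
    IsRearrangement (T.deleteEdges {s(z, z')}) (T'.deleteEdges {s(z, z')}) X := by
  refine ⟨fun a b hab => by simp [h.adj_iff a b hab], fun a b ha hb hadj => ?_⟩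
  refine (h.reachable a b ha hb (deleteEdges_adj.1 hadj).1).of_forall_adj fun c d hcd => ?_
  have : ((T'.deleteEdges {s(z, z')}).restrictTo X).Adj c d := by
    refine ⟨deleteEdges_adj.2 ⟨hcd.1, fun he => ?_⟩, hcd.2⟩
    have : z ∈ s(c, d) := by
      rw [Set.mem_singleton_iff.1 he]; simp
    rcases Sym2.mem_iff.1 this with rfl | rfl
    · exact hz hcd.2.1
    · exact hz hcd.2.2
  exact this.reachable

end IsRearrangement

/-- The graph that agrees with `B` inside `Y` and with `A` elsewhere. -/
def replaceOn (A B : SimpleGraph V) (Y : Set V) : SimpleGraph V where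
  Adj a b := (a ∈ Y ∧ b ∈ Y ∧ B.Adj a b) ∨ (¬(a ∈ Y ∧ b ∈ Y) ∧ A.Adj a b)
  symm := ⟨fun a b h => by
    rcases h with ⟨h1, h2, h3⟩ | ⟨h1, h2⟩
    · exact Or.inl ⟨h2, h1, h3.symm⟩
    · exact Or.inr ⟨fun h => h1 ⟨h.2, h.1⟩, h2.symm⟩⟩
  loopless := ⟨fun a h => by
    rcases h with ⟨_, _, h3⟩ | ⟨_, h2⟩
    · exact h3.ne rfl
    · exact h2.ne rfl⟩

/-- Since `X` and `Y` are disjoint, `A` still agrees with `T` inside `Y`, so the two rearrangements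
can be performed independently. -/
theorem IsRearrangement.replaceOn {T A B : SimpleGraph V} {X Y : Set V} (hXY : Disjoint X Y)
    (hA : IsRearrangement T A X) (hB : IsRearrangement T B Y) :
    IsRearrangement A (A.replaceOn B Y) Y := by
  refine ⟨fun a b hab => ?_, fun a b ha hb hadj => ?_⟩
  · simp only [SimpleGraph.replaceOn]; tauto
  · have h1 : ¬(a ∈ X ∧ b ∈ X) := fun h => Set.disjoint_left.1 hXY h.1 ha
    refine (hB.reachable a b ha hb ((hA.adj_iff a b h1).1 hadj)).of_forall_adj fun c d hcd => ?_
    have : ((A.replaceOn B Y).restrictTo Y).Adj c d := ⟨Or.inl ⟨hcd.2.1, hcd.2.2, hcd.1⟩, hcd.2⟩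
    exact this.reachable

variable [Fintype V]

open Classical in
/-- The exchange step: rearrangements inside disjoint sets `X` and `Y` are combined, the edge `xy`
is added and the edge `zz'` of a cycle through `xy` is removed. -/
theorem exists_exchange {H M T A B : SimpleGraph V} {X Y K : Set V} {F : V → ℕ} {x y z z' : V}
    (hXY : Disjoint X Y) (hXK : X ⊆ K) (hYK : Y ⊆ K)
    (hA : IsRearrangement T A X) (hB : IsRearrangement T B Y)
    (hMA : M ≤ A) (hMB : M ≤ B) (hAH : A ≤ H) (hBH : B ≤ H)
    (hAF : ∀ u ∈ X, A.degree u ≤ F u) (hBF : ∀ u ∈ Y, B.degree u ≤ F u)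
    (hx : x ∈ X) (hy : y ∈ Y) (hAx : A.degree x < F x) (hBy : B.degree y < F y)
    (hxy : H.Adj x y) (hzX : z ∉ X) (hzY : z ∉ Y) (hzz : T.Adj z z') (hzK : z ∈ K) (hzK' : z' ∈ K)
    (hM : ¬M.Adj z z')
    (hxz : ((T.deleteEdges {s(z, z')}).restrictTo K).Reachable x z)
    (hyz : ((T.deleteEdges {s(z, z')}).restrictTo K).Reachable z' y) :
    ∃ T' : SimpleGraph V, M ≤ T' ∧ T' ≤ H ∧ IsRearrangement T T' K ∧ T'.degree z < T.degree z ∧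
      ∀ u, T'.degree u ≤ F u ∨ T'.degree u ≤ T.degree u := by
  set C := A.replaceOn B Y with hC
  have hAC := hA.replaceOn hXY hB
  have hMC : M ≤ C := fun a b hab => by
    by_cases h : a ∈ Y ∧ b ∈ Y
    · exact Or.inl ⟨h.1, h.2, hMB hab⟩
    · exact Or.inr ⟨h, hMA hab⟩
  have hCH : C ≤ H := fun a b hab => by
    rcases hab with h | h
    · exact hBH h.2.2
    · exact hAH h.2
  have hdel : IsRearrangement (T.deleteEdges {s(z, z')}) (C.deleteEdges {s(z, z')}) K :=
    ((hA.deleteEdge hzX).mono hXK).trans ((hAC.deleteEdge hzY).mono hYK)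
  have hzx : z ≠ x := fun h => hzX (h ▸ hx)
  have hzy : z ≠ y := fun h => hzY (h ▸ hy)
  have hyX : y ∉ X := fun h => Set.disjoint_left.1 hXY h hy
  have hxY : x ∉ Y := fun h => Set.disjoint_left.1 hXY hx h
  obtain ⟨T', hT'⟩ : ∃ T' : SimpleGraph V, ∀ a b, T'.Adj a b ↔
      (C.deleteEdges {s(z, z')}).Adj a b ∨ (edge x y).Adj a b :=
    ⟨C.deleteEdges {s(z, z')} ⊔ edge x y, fun _ _ => Iff.rfl⟩
  have hle : C.deleteEdges {s(z, z')} ≤ T' := fun a b h => (hT' a b).2 (Or.inl h)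
  have hT'xy : (T'.restrictTo K).Adj x y :=
    ⟨(hT' _ _).2 (Or.inr (by simp [edge_adj, hxy.ne])), hXK hx, hYK hy⟩
  have nC : ∀ u, u ∉ X → u ∉ Y → C.neighborFinset u = T.neighborFinset u := by
    intro u h1 h2
    ext b
    simp only [mem_neighborFinset]
    rw [hAC.adj_iff u b (by tauto), hA.adj_iff u b (by tauto)]
  have nCX : ∀ u, u ∉ Y → C.neighborFinset u = A.neighborFinset u := by
    intro u h2
    ext b
    simp only [mem_neighborFinset]
    rw [hAC.adj_iff u b (by tauto)]
  have nCY : ∀ u, u ∈ Y → C.neighborFinset u = B.neighborFinset u := by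
    intro u h2
    have h1 : u ∉ X := fun h => Set.disjoint_left.1 hXY h h2
    ext b
    simp only [mem_neighborFinset]
    by_cases hb : b ∈ Y
    · constructor
      · rintro (h | h)
        · exact h.2.2
        · exact absurd ⟨h2, hb⟩ h.1
      · intro h
        exact Or.inl ⟨h2, hb, h⟩
    · rw [hAC.adj_iff u b (by tauto), hA.adj_iff u b (by tauto), hB.adj_iff u b (by tauto)]
  have nT' : ∀ u, u ≠ x → u ≠ y → T'.neighborFinset u ⊆ C.neighborFinset u := by
    intro u h1 h2 b hb
    simp only [mem_neighborFinset, hT'] at hb ⊢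
    rcases hb with h | h
    · exact (deleteEdges_adj.1 h).1
    · rw [edge_adj] at h
      tauto
  refine ⟨T', fun a b hab => ?_, fun a b hab => ?_, ⟨fun a b hab => ?_, fun a b ha hb hadj => ?_⟩,
    ?_, fun u => ?_⟩
  · refine hle (deleteEdges_adj.2 ⟨hMC hab, fun h => hM ?_⟩)
    exact (adj_congr_of_sym2 M (Set.mem_singleton_iff.1 h)).1 hab
  · rcases (hT' _ _).1 hab with h | h
    · exact hCH (deleteEdges_adj.1 h).1
    · rw [edge_adj] at h
      rcases h.1 with ⟨rfl, rfl⟩ | ⟨rfl, rfl⟩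
      · exact hxy
      · exact hxy.symm
  · have e1 : T'.Adj a b ↔ (C.deleteEdges {s(z, z')}).Adj a b := by
      refine ⟨fun h => ?_, fun h => hle h⟩
      rcases (hT' _ _).1 h with h | h
      · exact h
      · rw [edge_adj] at h
        have hx := hXK hx
        have hy := hYK hy
        rcases h.1 with ⟨rfl, rfl⟩ | ⟨rfl, rfl⟩ <;> tauto
    rw [e1, hdel.adj_iff a b hab, deleteEdges_adj]
    refine ⟨fun h => h.1, fun h => ⟨h, fun he => ?_⟩⟩
    rcases Sym2.eq_iff.1 (Set.mem_singleton_iff.1 he) with ⟨rfl, rfl⟩ | ⟨rfl, rfl⟩ <;> tauto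
  -- Only the removed edge needs a substitute: the detour from `z` to `x`, along the new edge to
  -- `y`, and on to `z'`.
  · by_cases he : s(a, b) = s(z, z')
    · have hzz' : (T'.restrictTo K).Reachable z z' :=
        (((hdel.reachable_restrictTo hxz).mono (restrictTo_mono hle le_rfl)).symm.trans
          hT'xy.reachable).trans
          ((hdel.reachable_restrictTo hyz).mono (restrictTo_mono hle le_rfl)).symm
      rcases Sym2.eq_iff.1 he with ⟨rfl, rfl⟩ | ⟨rfl, rfl⟩
      · exact hzz'
      · exact hzz'.symm
    · exact (hdel.reachable a b ha hb (deleteEdges_adj.2 ⟨hadj, he⟩)).mono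
        (restrictTo_mono hle le_rfl)
  · refine Finset.card_lt_card ((Finset.ssubset_iff_of_subset ?_).2 ⟨z', ?_, ?_⟩)
    · rw [← nC z hzX hzY]; exact nT' z hzx hzy
    · simpa using hzz
    · simp only [mem_neighborFinset, hT']
      rintro (h | h)
      · exact (deleteEdges_adj.1 h).2 rfl
      · rw [edge_adj] at h
        tauto
  -- Only `x` and `y` can gain a neighbour, at most one each, and the strict inequalities `hAx` and
  -- `hBy` leave room for it.
  · have hins : ∀ v, T'.neighborFinset v ⊆
        C.neighborFinset v ∪ (if v = x then {y} else if v = y then {x} else ∅) := by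
      intro v b hb
      simp only [mem_neighborFinset, Finset.mem_union, hT'] at hb ⊢
      rcases hb with h | h
      · exact Or.inl (deleteEdges_adj.1 h).1
      · rw [edge_adj] at h
        right
        rcases h.1 with ⟨rfl, rfl⟩ | ⟨rfl, rfl⟩
        · simp
        · simp [h.2]
    have hcard := fun v => (Finset.card_le_card (hins v)).trans (Finset.card_union_le _ _)
    by_cases hux : u = x
    · subst hux
      left
      have := hcard u
      rw [nCX u hxY] at this
      simp only [card_neighborFinset_eq_degree, if_true, Finset.card_singleton] at this
      omega
    by_cases huy : u = y
    · subst huy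
      left
      have := hcard u
      rw [nCY u hy] at this
      simp only [card_neighborFinset_eq_degree, if_neg hux, if_true,
        Finset.card_singleton] at this
      omega
    have h3 := Finset.card_le_card (nT' u hux huy)
    by_cases huX : u ∈ X
    · left
      rw [nCX u (fun h => Set.disjoint_left.1 hXY huX h)] at h3
      simp only [card_neighborFinset_eq_degree] at h3
      exact h3.trans (hAF u huX)
    by_cases huY : u ∈ Y
    · left
      rw [nCY u huY] at h3
      simp only [card_neighborFinset_eq_degree] at h3
      exact h3.trans (hBF u huY)
    · right
      rw [nC u huX huY] at h3
      simpa only [card_neighborFinset_eq_degree] using h3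

end

/-! ### Spanning trees of bounded degree that contain a matching. -/

section

/-- An added edge between two components lowers the number of components, which reduces the claim to
connected graphs. -/
theorem card_le_card_edgeSet_add_card_connectedComponent [Finite V] (G : SimpleGraph V) :
    Nat.card V ≤ Nat.card G.edgeSet + Nat.card G.ConnectedComponent := by
  classical
  cases nonempty_fintype V
  induction hn : Nat.card G.ConnectedComponent using Nat.strong_induction_on generalizing G with
  | _ n ih =>
    by_cases hG : G.Preconnected
    · rcases isEmpty_or_nonempty V with hV | hV
      · simp
      · have h1 := Connected.card_vert_le_card_edgeSet_add_one (G := G) ⟨hG⟩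
        have : 0 < n := hn ▸ Nat.card_pos
        omega
    · obtain ⟨a, b, hab⟩ : ∃ a b, ¬G.Reachable a b := by simpa [Preconnected] using hG
      have hle : G ≤ G ⊔ edge a b := le_sup_left
      have hne : a ≠ b := fun h => hab (h ▸ Reachable.refl _)
      have hadj : (G ⊔ edge a b).Adj a b := Or.inr (by simp [edge_adj, hne])
      have hlt : Nat.card (G ⊔ edge a b).ConnectedComponent < n := by
        rw [← hn, Nat.card_eq_fintype_card, Nat.card_eq_fintype_card]
        refine Fintype.card_lt_of_surjective_not_injective
          (ConnectedComponent.map (Hom.ofLE hle)) ?_ fun hinj => hab ?_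
        · intro c
          induction c using ConnectedComponent.ind with
          | h v => exact ⟨G.connectedComponentMk v, rfl⟩
        · exact ConnectedComponent.exact (hinj (ConnectedComponent.sound hadj.reachable))
      have h1 := ih _ hlt _ rfl
      have h2 : Nat.card (G ⊔ edge a b).edgeSet ≤ Nat.card G.edgeSet + 1 := by
        rw [edgeSet_sup, edgeSet_edge_of_ne hne]
        simpa only [Nat.card_coe_set_eq, Set.ncard_singleton] using
          Set.ncard_union_le G.edgeSet {s(a, b)}
      omega

theorem IsAcyclic.card_edgeSet_lt [Finite V] [Nonempty V] {G : SimpleGraph V} (h : G.IsAcyclic) :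
    Nat.card G.edgeSet + 1 ≤ Nat.card V := by
  classical
  cases nonempty_fintype V
  obtain ⟨T, hGT, -, hT⟩ := Connected.exists_isTree_le_of_le_of_isAcyclic
    (G := (⊤ : SimpleGraph V)) (H := G) connected_top le_top h
  rw [Nat.card_eq_fintype_card, Nat.card_eq_fintype_card, ← hT.card_edgeFinset, card_edgeSet]
  gcongr

/-- A trail does not repeat the edge `za`, so its pieces before and after this edge survive the
deletion. -/
theorem Walk.IsTrail.reachable_deleteEdges_of_append_cons {T : SimpleGraph V} {K : Set V}
    {x y z a : V} {q : T.Walk x z} {h : T.Adj z a} {r : T.Walk a y}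
    (hp : (q.append (cons h r)).IsTrail) (hK : ∀ v ∈ (q.append (cons h r)).support, v ∈ K) :
    ((T.deleteEdges {s(z, a)}).restrictTo K).Reachable x z ∧
      ((T.deleteEdges {s(z, a)}).restrictTo K).Reachable a y := by
  have hn := hp.edges_nodup
  rw [edges_append, edges_cons, List.nodup_append] at hn
  constructor
  · refine q.reachable_restrictTo_deleteEdges
      (fun v hv => hK v (by rw [mem_support_append_iff]; exact Or.inl hv)) fun e he h' => ?_
    exact hn.2.2 e he _ List.mem_cons_self h'
  · refine r.reachable_restrictTo_deleteEdges
      (fun v hv => hK v (by rw [mem_support_append_iff]; simp [hv])) fun e he h' => ?_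
    exact (List.nodup_cons.1 hn.2.1).1 (Set.mem_singleton_iff.1 h' ▸ he)

open Classical in
theorem two_mul_card_edgeSet_induce [Finite V] (T : SimpleGraph V) (D : Finset V) :
    2 * Nat.card (T.induce (D : Set V)).edgeSet =
      ∑ v ∈ D, ∑ w ∈ D, if T.Adj v w then 1 else 0 := by
  rw [Nat.card_eq_fintype_card, card_edgeSet, ← sum_degrees_eq_twice_card_edges,
    ← Finset.sum_coe_sort D]
  refine Finset.sum_congr rfl fun v _ => ?_
  rw [← card_neighborFinset_eq_degree, neighborFinset_eq_filter, Finset.card_filter,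
    ← Finset.sum_coe_sort D]
  rfl

variable [Fintype V]

open Classical in
/-- Deleting a nonempty set `D` from a tree leaves at least `∑_{v ∈ D} (d(v) - 2) + 2` components. -/
theorem IsTree.sum_degree_add_two_le {T : SimpleGraph V} (hT : T.IsTree) {D : Finset V}
    (hD : D.Nonempty) :
    ∑ v ∈ D, T.degree v + 2 ≤
      Nat.card (T.induce ((Dᶜ : Finset V) : Set V)).ConnectedComponent + 2 * D.card := by
  have h1 := two_mul_card_edgeSet_induce T D
  have h2 := two_mul_card_edgeSet_induce T Dᶜ
  have hne : Nonempty (D : Set V) := hD.to_subtype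
  have h3 := (hT.isAcyclic.induce (D : Set V)).card_edgeSet_lt
  have h4 := card_le_card_edgeSet_add_card_connectedComponent (T.induce ((Dᶜ : Finset V) : Set V))
  have h5 : ∀ v, T.degree v = ∑ w ∈ D, (if T.Adj v w then 1 else 0) +
      ∑ w ∈ Dᶜ, (if T.Adj v w then 1 else 0) := by
    intro v
    rw [Finset.sum_add_sum_compl, ← card_neighborFinset_eq_degree, neighborFinset_eq_filter,
      Finset.card_filter]
  have h6 := sum_degrees_eq_twice_card_edges T
  have h7 := hT.card_edgeFinset
  have h8 : ∑ v ∈ D, ∑ w ∈ Dᶜ, (if T.Adj v w then 1 else 0) =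
      ∑ v ∈ Dᶜ, ∑ w ∈ D, (if T.Adj v w then 1 else 0) := by
    rw [Finset.sum_comm]
    simp only [T.adj_comm]
  have h9 : ∑ v ∈ D, T.degree v = ∑ v ∈ D, ∑ w ∈ D, (if T.Adj v w then 1 else 0) +
      ∑ v ∈ D, ∑ w ∈ Dᶜ, (if T.Adj v w then 1 else 0) := by
    rw [← Finset.sum_add_distrib]; exact Finset.sum_congr rfl fun v _ => h5 v
  have h10 : ∑ v ∈ Dᶜ, T.degree v = ∑ v ∈ Dᶜ, ∑ w ∈ D, (if T.Adj v w then 1 else 0) +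
      ∑ v ∈ Dᶜ, ∑ w ∈ Dᶜ, (if T.Adj v w then 1 else 0) := by
    rw [← Finset.sum_add_distrib]; exact Finset.sum_congr rfl fun v _ => h5 v
  have h11 := Finset.sum_add_sum_compl D (fun v => T.degree v)
  have h12 : Nat.card (D : Set V) = D.card := by simp
  have h13 : Nat.card ((Dᶜ : Finset V) : Set V) = Fintype.card V - D.card := by
    rw [← Finset.card_compl, Nat.card_eq_fintype_card]
    exact Fintype.card_coe _
  have h14 := D.card_le_univ
  rw [h12] at h3
  rw [h13] at h4
  omega

/-- `ω(H ∖ D) ≤ ∑_{v ∈ D} (f v - 1) + 1` for all `D`: a map onto `I` from the vertices outside `D`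
that is constant on edges exists exactly if `H ∖ D` has at least `|I|` components. -/
def ComponentBound (H : SimpleGraph V) (f : V → ℕ) : Prop :=
  ∀ (D : Finset V) (I : Type u) (φ : {v // v ∉ D} → I), Function.Surjective φ →
    (∀ a b : {v // v ∉ D}, H.Adj a b → φ a = φ b) →
    (Nat.card I : ℤ) ≤ ∑ v ∈ D, ((f v : ℤ) - 1) + 1

theorem ComponentBound.preconnected {H : SimpleGraph V} {f : V → ℕ} (h : ComponentBound H f) :
    H.Preconnected := by
  have h1 := h ∅ H.ConnectedComponent (fun v => H.connectedComponentMk v)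
    (fun c => by
      induction c using ConnectedComponent.ind with
      | h v => exact ⟨⟨v, by simp⟩, rfl⟩)
    (fun a b hab => ConnectedComponent.sound hab.reachable)
  have h2 : Nat.card H.ConnectedComponent ≤ 1 := by simpa using h1
  have := (Finite.card_le_one_iff_subsingleton).1 h2
  exact fun a b => ConnectedComponent.exact (Subsingleton.elim _ _)

open Classical in
/-- Every vertex outside `D` can be given degree less than its bound by rearranging `T` inside its
component of `T ∖ D`; the vertices of `D` reach their bounds, and no vertex outside `D` exceeds
its bound. -/
structure IsBarrier (H M T : SimpleGraph V) (F : V → ℕ) (D : Finset V) : Prop where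
  le_degree : ∀ v ∈ D, F v ≤ T.degree v
  degree_le : ∀ v ∉ D, T.degree v ≤ F v
  exists_lt : ∀ v ∉ D, ∃ T' : SimpleGraph V, M ≤ T' ∧ T' ≤ H ∧
    IsRearrangement T T' {u | (T.restrictTo {w | w ∉ D}).Reachable v u} ∧
    (∀ u, (T.restrictTo {w | w ∉ D}).Reachable v u → T'.degree u ≤ F u) ∧ T'.degree v < F v

-- Provides a first barrier, so that a smallest one exists; `T` itself serves as every required
-- rearrangement.
open Classical in
theorem isBarrier_saturated {H M T : SimpleGraph V} (hMT : M ≤ T) (hTH : T ≤ H) (F : V → ℕ) :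
    IsBarrier H M T F {v | F v ≤ T.degree v} := by
  refine ⟨by simp, fun v hv => by simp at hv; omega, fun v hv => ?_⟩
  refine ⟨T, hMT, hTH, .refl _ _, fun u hu => ?_, by simpa using hv⟩
  have := hu.mem_of_restrictTo hv
  simp at this; omega

open Classical in
/-- If an edge of `H` joins two components of `T ∖ D`, then any vertex of `D` on the path of `T`
between its ends can be given a smaller degree. -/
theorem IsBarrier.exists_exchange {H M T : SimpleGraph V} {F : V → ℕ} {D : Finset V}
    (hM : ∀ a b c, M.Adj a b → M.Adj a c → b = c) (hD : IsBarrier H M T F D)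
    {x y z : V} (hx : x ∉ D) (hy : y ∉ D) (hxy : H.Adj x y)
    (hnr : ¬(T.restrictTo {w | w ∉ D}).Reachable x y) {p : T.Walk x y} (hp : p.IsPath)
    (hz : z ∈ p.support) (hzD : z ∈ D) {K : Set V} (hpK : ∀ v ∈ p.support, v ∈ K)
    (hK : ∀ v ∈ K, ∀ u, (T.restrictTo {w | w ∉ D}).Reachable v u → u ∈ K) :
    ∃ T' : SimpleGraph V, M ≤ T' ∧ T' ≤ H ∧ IsRearrangement T T' K ∧ T'.degree z < T.degree z ∧
      ∀ u, T'.degree u ≤ F u ∨ T'.degree u ≤ T.degree u := by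
  obtain ⟨A, hMA, hAH, hA, hAF, hAx⟩ := hD.exists_lt x hx
  obtain ⟨B, hMB, hBH, hB, hBF, hBy⟩ := hD.exists_lt y hy
  have hXY : Disjoint {u | (T.restrictTo {w | w ∉ D}).Reachable x u}
      {u | (T.restrictTo {w | w ∉ D}).Reachable y u} :=
    Set.disjoint_left.2 fun u h1 h2 => hnr (h1.trans h2.symm)
  have hXK : {u | (T.restrictTo {w | w ∉ D}).Reachable x u} ⊆ K :=
    fun u hu => hK x (hpK x p.start_mem_support) u hu
  have hYK : {u | (T.restrictTo {w | w ∉ D}).Reachable y u} ⊆ K :=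
    fun u hu => hK y (hpK y p.end_mem_support) u hu
  have hzX : z ∉ {u | (T.restrictTo {w | w ∉ D}).Reachable x u} :=
    fun h => h.mem_of_restrictTo hx hzD
  have hzY : z ∉ {u | (T.restrictTo {w | w ∉ D}).Reachable y u} :=
    fun h => h.mem_of_restrictTo hy hzD
  have hzx : z ≠ x := fun h => hx (h ▸ hzD)
  have hzy : z ≠ y := fun h => hy (h ▸ hzD)
  obtain ⟨q, r, rfl⟩ := Walk.mem_support_iff_exists_append.1 hz
  cases r with
  | nil => exact absurd rfl hzy
  | @cons _ a _ ha r =>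
    -- At most one of the two path edges at `z` lies in `M`. If it is the edge after `z`, the edge
    -- before `z` is removed instead, by reversing the path.
    by_cases hMa : M.Adj z a
    · cases hq : q.reverse with
      | nil => exact absurd rfl hzx
      | @cons _ b _ hb q' =>
        have hp' := hp.reverse
        have hpK' : ∀ v ∈ (q.append (Walk.cons ha r)).reverse.support, v ∈ K := by
          simpa only [Walk.support_reverse, List.mem_reverse] using hpK
        rw [Walk.reverse_append, hq] at hp' hpK'
        have hab : a ≠ b := by
          have hn := hp'.support_nodup
          rw [Walk.support_append, List.nodup_append] at hn
          exact hn.2.2 a (by simp) b (by simp)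
        have hMb : ¬M.Adj z b := fun h => hab (hM z a b hMa h)
        obtain ⟨h1, h2⟩ := hp'.isTrail.reachable_deleteEdges_of_append_cons hpK'
        exact SimpleGraph.exists_exchange hXY.symm hYK hXK hB hA hMB hMA hBH hAH hBF hAF
          (Reachable.refl y) (Reachable.refl x) hBy hAx hxy.symm hzY hzX hb (hpK' z (by simp))
          (hpK' b (by simp)) hMb h1 h2
    · obtain ⟨h1, h2⟩ := hp.isTrail.reachable_deleteEdges_of_append_cons hpK
      exact SimpleGraph.exists_exchange hXY hXK hYK hA hB hMA hMB hAH hBH hAF hBF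
        (Reachable.refl x) (Reachable.refl y) hAx hBy hxy hzX hzY ha (hpK z (by simp))
        (hpK a (by simp)) hMa h1 h2

open Classical in
/-- The total amount by which the degrees of `T` exceed the bounds `F`. -/
noncomputable def excess (T : SimpleGraph V) (F : V → ℕ) : ℕ := ∑ v, (T.degree v - F v)

open Classical in
theorem excess_mono {T T' : SimpleGraph V} (h : T ≤ T') (F : V → ℕ) :
    T.excess F ≤ T'.excess F :=
  Finset.sum_le_sum fun _ _ => Nat.sub_le_sub_right (degree_le_of_le h) _

open Classical in
/-- If `T` has least excess, then no edge of `H` joins two components of `T ∖ D`, for a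
barrier `D` of least size. -/
theorem IsBarrier.reachable_of_adj {H M T : SimpleGraph V} {F : V → ℕ} {D : Finset V}
    (hM : ∀ a b c, M.Adj a b → M.Adj a c → b = c) (hT : T.Connected)
    (hmin : ∀ T' : SimpleGraph V, M ≤ T' → T' ≤ H → T'.Connected → T.excess F ≤ T'.excess F)
    (hD : IsBarrier H M T F D) (hDmin : ∀ D', IsBarrier H M T F D' → D.card ≤ D'.card)
    {x y : V} (hx : x ∉ D) (hy : y ∉ D) (hxy : H.Adj x y) :
    (T.restrictTo {w | w ∉ D}).Reachable x y := by
  by_contra hnr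
  obtain ⟨p, hp⟩ := hT.exists_isPath x y
  -- Removing the path's vertices from `D` merges the components along it; `D'` will be a smaller
  -- barrier.
  set D' := D.filter (fun v => v ∉ p.support) with hD'
  have hmono : T.restrictTo {w | w ∉ D} ≤ T.restrictTo {w | w ∉ D'} :=
    restrictTo_mono le_rfl fun w hw hw' => hw (Finset.mem_filter.1 hw').1
  have hpr : ∀ v ∈ p.support, (T.restrictTo {w | w ∉ D'}).Reachable x v := by
    intro v hv
    obtain ⟨q, r, rfl⟩ := Walk.mem_support_iff_exists_append.1 hv
    have := q.reachable_restrictTo_deleteEdges (K := {w | w ∉ D'}) (E := ∅)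
      (fun u hu hu' => (Finset.mem_filter.1 hu').2 (by
        rw [Walk.mem_support_append_iff]; exact Or.inl hu)) (by simp)
    simpa using this
  obtain ⟨z, hz, hzD⟩ : ∃ z ∈ p.support, z ∈ D := by
    by_contra! hcon
    refine hnr ?_
    have := p.reachable_restrictTo_deleteEdges (K := {w | w ∉ D}) (E := ∅) hcon (by simp)
    simpa using this
  have hex := fun z hz hzD => hD.exists_exchange hM hx hy hxy hnr hp (z := z) hz hzD
    (K := {u | (T.restrictTo {w | w ∉ D'}).Reachable x u}) hpr
    (fun v hv u hu => Reachable.trans hv (hu.mono hmono))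
  have hle : ∀ z ∈ p.support, T.degree z ≤ F z := by
    intro z hz
    by_cases hzD : z ∈ D
    -- An exchange at a vertex above its bound would strictly lower the total excess.
    · by_contra! hlt
      obtain ⟨T', h1, h2, h3, h4, h5⟩ := hex z hz hzD
      refine absurd (hmin T' h1 h2 (h3.connected hT)) (not_le.2 ?_)
      refine Finset.sum_lt_sum (fun u _ => ?_) ⟨z, Finset.mem_univ _, ?_⟩
      · rcases h5 u with h | h <;> omega
      · omega
    · exact hD.degree_le z hzD
  have hle' : ∀ v ∉ D', T.degree v ≤ F v := by
    intro v hv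
    by_cases hvD : v ∈ D
    · refine hle v ?_
      by_contra h
      exact hv (Finset.mem_filter.2 ⟨hvD, h⟩)
    · exact hD.degree_le v hvD
  have hbar : IsBarrier H M T F D' := by
    refine ⟨fun v hv => hD.le_degree v (Finset.mem_filter.1 hv).1, hle', fun v hv => ?_⟩
    -- A vertex that has left `D` lies on the path and has degree at most its bound, so the exchange
    -- at it brings it strictly below.
    by_cases hvD : v ∈ D
    · have hvp : v ∈ p.support := by
        by_contra h
        exact hv (Finset.mem_filter.2 ⟨hvD, h⟩)
      obtain ⟨T', h1, h2, h3, h4, h5⟩ := hex v hvp hvD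
      have hxv := hpr v hvp
      refine ⟨T', h1, h2, h3.mono fun u hu => hxv.symm.trans hu, fun u hu => ?_,
        h4.trans_le (hle v hvp)⟩
      exact (h5 u).elim id fun h => h.trans (hle' u (hu.mem_of_restrictTo hv))
    · obtain ⟨T', h1, h2, h3, h4, h5⟩ := hD.exists_lt v hvD
      refine ⟨T', h1, h2, h3.mono fun u hu => hu.mono hmono, fun u hu => ?_, h5⟩
      by_cases hu' : (T.restrictTo {w | w ∉ D}).Reachable v u
      · exact h4 u hu'
      · have : T'.degree u = T.degree u := by
          rw [← card_neighborFinset_eq_degree, ← card_neighborFinset_eq_degree]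
          congr 1
          ext b
          simp only [mem_neighborFinset]
          exact h3.adj_iff u b fun h => hu' h.1
        rw [this]
        exact hle' u (hu.mem_of_restrictTo hv)
  refine absurd (hDmin D' hbar) (not_le.2 (Finset.card_lt_card ?_))
  exact Finset.filter_ssubset.2 ⟨z, hzD, not_not.2 hz⟩

open Classical in
/-- Under the component bound for `f`, every matching extends to a spanning tree with degrees at
most `f + 1`. -/
theorem ComponentBound.exists_isTree [Nonempty V] {H M : SimpleGraph V} {f : V → ℕ}
    (hH : ComponentBound H f) (hMH : M ≤ H) (hM : ∀ a b c, M.Adj a b → M.Adj a c → b = c) :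
    ∃ T : SimpleGraph V, M ≤ T ∧ T ≤ H ∧ T.IsTree ∧ ∀ v, T.degree v ≤ f v + 1 := by
  set F : V → ℕ := fun v => f v + 1 with hF
  obtain ⟨T₀, ⟨h1, h2, h3⟩, h4⟩ := Set.exists_min_image
    {T : SimpleGraph V | M ≤ T ∧ T ≤ H ∧ T.Connected} (fun T => T.excess F) (Set.toFinite _)
    ⟨H, hMH, le_rfl, ⟨hH.preconnected⟩⟩
  obtain ⟨T, ⟨hMT, hTH, hTc, hTe⟩, hTmin⟩ := Set.exists_min_image
    {T : SimpleGraph V | M ≤ T ∧ T ≤ H ∧ T.Connected ∧ T.excess F ≤ T₀.excess F}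
    (fun T => Nat.card T.edgeSet) (Set.toFinite _) ⟨T₀, h1, h2, h3, le_rfl⟩
  have hacyc : T.IsAcyclic := by
    intro v c hc
    -- The first and last edges of the cycle share `v`, so they cannot both belong to the matching.
    obtain ⟨e, he, heM⟩ : ∃ e ∈ c.edges, e ∉ M.edgeSet := by
      by_contra! hcon
      have hs := hcon _ (c.mk_start_snd_mem_edges hc.not_nil)
      have hp := hcon _ (c.mk_penultimate_end_mem_edges hc.not_nil)
      exact hc.snd_ne_penultimate (hM v _ _ hs (M.adj_symm hp))
    have hlt : T.deleteEdges {e} < T := by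
      refine lt_of_le_of_ne (deleteEdges_le _) fun h => ?_
      have : e ∈ (T.deleteEdges {e}).edgeSet := by rw [h]; exact c.edges_subset_edgeSet he
      simp [edgeSet_deleteEdges] at this
    have hconn : (T.deleteEdges {e}).Connected := by
      have hb : ¬T.IsBridge e := fun h => h.notMem_edges_of_isCycle hc he
      induction e using Sym2.ind with
      | _ a b => exact hTc.connected_delete_edge_of_not_isBridge hb
    refine absurd (hTmin (T.deleteEdges {e}) ⟨fun a b hab => ?_, hlt.le.trans hTH, hconn, ?_⟩)
      (not_le.2 ?_)
    · refine deleteEdges_adj.2 ⟨hMT hab, fun h => heM ?_⟩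
      exact Set.mem_singleton_iff.1 h ▸ hab
    · exact (excess_mono hlt.le F).trans hTe
    · exact Set.ncard_lt_ncard (edgeSet_ssubset_edgeSet.2 hlt) (Set.toFinite _)
  refine ⟨T, hMT, hTH, ⟨hTc, hacyc⟩, ?_⟩
  by_contra! hcon
  obtain ⟨v, hv⟩ := hcon
  obtain ⟨D, hD, hDmin⟩ := Set.exists_min_image {D | IsBarrier H M T F D} Finset.card
    (Set.toFinite _) ⟨_, isBarrier_saturated hMT hTH F⟩
  have hvD : v ∈ D := by
    by_contra h
    exact absurd (hD.degree_le v h) (not_le.2 hv)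
  have hcount := IsTree.sum_degree_add_two_le ⟨hTc, hacyc⟩ ⟨v, hvD⟩
  have hset : {w | w ∉ D} = ((Dᶜ : Finset V) : Set V) := by ext; simp
  have hbound := hH D (T.induce ((Dᶜ : Finset V) : Set V)).ConnectedComponent
    (fun w => connectedComponentMk _ ⟨w.1, by simp⟩)
    (fun c => by
      induction c using ConnectedComponent.ind with
      | h w => exact ⟨⟨w.1, by simpa using w.2⟩, rfl⟩)
    (fun a b hab => by
      have := hD.reachable_of_adj hM hTc
        (fun T' h1 h2 h3 => hTe.trans (h4 T' ⟨h1, h2, h3⟩)) hDmin a.2 b.2 hab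
      rw [hset] at this
      exact ConnectedComponent.sound (this.induce_of_restrictTo _ _))
  -- The degree sum over `D` is at least `∑ f + |D|` by the barrier, but at most `∑ f + |D| - 1` by
  -- `hcount` and `hbound`.
  have hsum := Finset.sum_le_sum hD.le_degree
  simp only [hF, Finset.sum_add_distrib, Finset.sum_const, smul_eq_mul, mul_one] at hsum
  simp only [Finset.sum_sub_distrib, Finset.sum_const, nsmul_eq_mul, mul_one] at hbound
  rw [← Nat.cast_sum] at hbound
  omega

end

/-! ### Eulerian closed walks. -/

section

-- Each visit uses two edge ends, up to a correction at the two ends of the walk. This gives both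
-- the parity at the end of an open walk and the number of visits of a closed one.
open Classical in
theorem Walk.countP_mem_edges {H : SimpleGraph V} {x y : V} (p : H.Walk x y) (v : V) :
    p.edges.countP (v ∈ ·) + (if v = y then 1 else 0) =
      2 * p.support.tail.count v + (if v = x then 1 else 0) := by
  induction p with
  | nil => simp
  | @cons a b c h p ih =>
    have hs : p.support.count v = p.support.tail.count v + (if v = b then 1 else 0) := by
      rw [← p.cons_tail_support, List.count_cons]
      simp only [beq_iff_eq, eq_comm (a := b), List.tail_cons]
    have he : (if v ∈ s(a, b) then 1 else 0) =
        (if v = a then 1 else 0) + (if v = b then 1 else 0) := by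
      have := h.ne
      by_cases h1 : v = a <;> by_cases h2 : v = b <;> simp_all
    simp only [edges_cons, List.countP_cons, support_cons, List.tail_cons, decide_eq_true_eq]
    omega

variable [Fintype V]

open Classical in
theorem countP_mem_eq_sum_count (l : List (Sym2 V)) (v : V) :
    l.countP (v ∈ ·) = ∑ w, l.count s(v, w) := by
  induction l with
  | nil => simp
  | cons e l ih =>
    simp only [List.countP_cons, List.count_cons, Finset.sum_add_distrib, ih, decide_eq_true_eq,
      beq_iff_eq]
    congr 1
    by_cases h : v ∈ e
    · obtain ⟨w, rfl⟩ := Sym2.mem_iff_exists.1 h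
      rw [if_pos h, Finset.sum_eq_single w]
      · simp
      · intro b _ hb
        rw [if_neg]
        intro h'
        exact hb (Sym2.congr_right.1 h').symm
      · simp
    · rw [if_neg h, eq_comm]
      refine Finset.sum_eq_zero fun w _ => if_neg ?_
      rintro rfl
      exact h (by simp)

open Classical in
theorem length_le_sum_countP_mem (l : List (Sym2 V)) : l.length ≤ ∑ v, l.countP (v ∈ ·) := by
  induction l with
  | nil => simp
  | cons e l ih =>
    simp only [List.countP_cons, Finset.sum_add_distrib, List.length_cons, decide_eq_true_eq]
    refine Nat.add_le_add ih ?_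
    induction e using Sym2.ind with
    | _ a b =>
      refine le_trans ?_ (Finset.single_le_sum (fun _ _ => Nat.zero_le _) (Finset.mem_univ a))
      simp

open Classical in
/-- Euler's theorem for a connected multigraph with even degrees, given by the numbers `m a b` of
edges between `a` and `b`. -/
theorem exists_eulerian_closed_walk [Nonempty V] {H : SimpleGraph V} {m : V → V → ℕ}
    (hsymm : ∀ a b, m a b = m b a) (hadj : ∀ a b, 0 < m a b → H.Adj a b)
    (heven : ∀ v, Even (∑ w, m v w))
    (hconn : ∀ s : Set V, s.Nonempty → (∀ a ∈ s, ∀ b, 0 < m a b → b ∈ s) → s = Set.univ) :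
    ∃ (x : V) (p : H.Walk x x), (∀ v, v ∈ p.support) ∧ (∀ a b, p.edges.count s(a, b) = m a b) := by
  have hdeg : ∀ {x y : V} (p : H.Walk x y), (∀ a b, p.edges.count s(a, b) ≤ m a b) →
      ∀ v, p.edges.countP (v ∈ ·) ≤ ∑ w, m v w := fun p hp v => by
    rw [countP_mem_eq_sum_count]
    exact Finset.sum_le_sum fun w _ => hp v w
  -- A longest walk using no edge more often than `m` allows will be the tour.
  let L : Set ℕ := {n | ∃ (x y : V) (p : H.Walk x y),
    (∀ a b, p.edges.count s(a, b) ≤ m a b) ∧ p.length = n}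
  have hLne : L.Nonempty :=
    ⟨0, Classical.arbitrary V, _, Walk.nil, by simp, by simp⟩
  have hLb : BddAbove L := by
    refine ⟨∑ v, ∑ w, m v w, ?_⟩
    rintro _ ⟨x, y, p, hp, rfl⟩
    rw [← p.length_edges]
    exact (length_le_sum_countP_mem _).trans (Finset.sum_le_sum fun v _ => hdeg p hp v)
  obtain ⟨x, y, p, hp, hlen⟩ := Nat.sSup_mem hLne hLb
  have hmax : ∀ {x' y' : V} (q : H.Walk x' y'), (∀ a b, q.edges.count s(a, b) ≤ m a b) →
      q.length ≤ p.length := fun q hq => hlen ▸ le_csSup hLb ⟨_, _, q, hq, rfl⟩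
  have hcons : ∀ {a b : V} (l : List (Sym2 V)), (∀ c d, l.count s(c, d) ≤ m c d) →
      l.count s(a, b) < m a b → ∀ c d, (s(a, b) :: l).count s(c, d) ≤ m c d := by
    intro a b l hl hlt c d
    rw [List.count_cons]
    split_ifs with h
    · rcases Sym2.eq_iff.1 (beq_iff_eq.1 h) with ⟨rfl, rfl⟩ | ⟨rfl, rfl⟩
      · exact hlt
      · rw [hsymm, Sym2.eq_swap]; exact hlt
    · exact hl c d
  have hxy : x = y := by
    by_contra hne
    -- An open walk uses an odd number of edge ends at `y`, while the degree there is even, so an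
    -- unused edge remains and extends the walk.
    have h1 := p.countP_mem_edges y
    rw [if_pos rfl, if_neg (Ne.symm hne)] at h1
    have h2 : p.edges.countP (y ∈ ·) < ∑ w, m y w := by
      refine lt_of_le_of_ne (hdeg p hp y) fun h => ?_
      obtain ⟨k, hk⟩ := heven y
      omega
    rw [countP_mem_eq_sum_count] at h2
    obtain ⟨w, -, hw⟩ := Finset.exists_lt_of_sum_lt h2
    have hyw := hadj y w (by omega)
    have h3 := hmax (Walk.cons hyw.symm p.reverse) (by
      rw [Walk.edges_cons]
      refine hcons _ (fun c d => ?_) ?_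
      · rw [Walk.edges_reverse, List.count_reverse]; exact hp c d
      · rw [Walk.edges_reverse, List.count_reverse, Sym2.eq_swap, ← hsymm]; exact hw)
    simp at h3
  subst hxy
  have hfull : ∀ a ∈ p.support, ∀ b, p.edges.count s(a, b) = m a b := by
    intro a ha b
    refine le_antisymm (hp a b) ?_
    by_contra! hlt
    have hab := hadj a b (by omega)
    have hperm := (p.rotate_edges a ha).perm
    -- The closed walk can be restarted at `a` and then lengthened by an unused edge there.
    have h3 := hmax (Walk.cons hab.symm (p.rotate a ha)) (by
      rw [Walk.edges_cons]
      refine hcons _ (fun c d => ?_) ?_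
      · rw [hperm.count_eq]; exact hp c d
      · rw [hperm.count_eq, Sym2.eq_swap, ← hsymm]; exact hlt)
    have h4 : (p.rotate a ha).length = p.length := by
      rw [← Walk.length_edges, ← Walk.length_edges, hperm.length_eq]
    simp [h4] at h3
  have huniv : {v | v ∈ p.support} = Set.univ := by
    refine hconn _ ⟨x, p.start_mem_support⟩ fun a ha b hab => ?_
    rw [← hfull a ha b] at hab
    exact p.snd_mem_support_of_mem_edges (List.count_pos_iff.1 hab)
  have hsupp : ∀ v, v ∈ p.support := fun v => (huniv ▸ Set.mem_univ v : v ∈ {v | v ∈ p.support})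
  exact ⟨x, p, hsupp, fun a b => hfull a (hsupp a) b⟩

end

/-! ### Parity correction through Tutte's theorem on a blow-up. -/

section

/-- The graph obtained from `H` by replacing each vertex `v` by a clique of `h v` copies. -/
def blowUp (H : SimpleGraph V) (h : V → ℕ) : SimpleGraph (Σ v, Fin (h v)) where
  Adj p q := H.Adj p.1 q.1 ∨ (p.1 = q.1 ∧ p ≠ q)
  symm := ⟨fun _ _ hpq => hpq.imp (·.symm) fun h => ⟨h.1.symm, h.2.symm⟩⟩
  loopless := ⟨fun _ hp => hp.elim (fun h => h.ne rfl) fun h => h.2 rfl⟩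

theorem even_card_of_involution {ι : Type*} {s : Finset ι} {σ : ι → ι} (hσ : ∀ a ∈ s, σ a ∈ s)
    (hinv : ∀ a ∈ s, σ (σ a) = a) (hne : ∀ a ∈ s, σ a ≠ a) : Even s.card := by
  have h : ∑ a ∈ s, (1 : ZMod 2) = 0 :=
    Finset.sum_involution (fun a _ => σ a) (fun _ _ => by decide) (fun a ha _ => hne a ha)
      (fun a ha => hσ a ha) (fun a ha => hinv a ha)
  rw [Finset.sum_const, nsmul_eq_mul, mul_one] at h
  exact (ZMod.natCast_eq_zero_iff_even).1 h

variable [Fintype V]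

-- With `S` the set of vertices all of whose copies lie in `X`, the components left by `X`
-- correspond to those of `H ∖ S`. So there are at most `∑_{v ∈ S} h v + 1 ≤ |X| + 1` of them, and
-- parity excludes exactly `|X| + 1` odd ones.
open Classical in
theorem ComponentBound.not_isTutteViolator {H : SimpleGraph V} {f h : V → ℕ}
    (hH : ComponentBound H f) (hfh : ∀ v, f v ≤ h v + 1) (heven : Even (∑ v, h v))
    (X : Set (Σ v, Fin (h v))) : ¬(H.blowUp h).IsTutteViolator X := by
  set K := ((⊤ : (H.blowUp h).Subgraph).deleteVerts X).coe with hK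
  set S : Finset V := {v | ∀ i, (⟨v, i⟩ : Σ v, Fin (h v)) ∈ X} with hS
  have hmem : ∀ p : Σ v, Fin (h v), p ∉ X → p ∈ ((⊤ : (H.blowUp h).Subgraph).deleteVerts X).verts :=
    fun p hp => by simpa using hp
  have hcopy : ∀ v : {v // v ∉ S}, ∃ i, (⟨v.1, i⟩ : Σ v, Fin (h v)) ∉ X := fun v => by
    simpa [hS] using v.2
  choose c hc using hcopy
  have hcomp : ∀ p q (hp : p ∉ X) (hq : q ∉ X), (H.Adj p.1 q.1 ∨ p.1 = q.1) →
      K.connectedComponentMk ⟨p, hmem p hp⟩ = K.connectedComponentMk ⟨q, hmem q hq⟩ := by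
    intro p q hp hq hpq
    by_cases he : p = q
    · subst he; rfl
    · refine ConnectedComponent.sound (Adj.reachable ?_)
      simp only [hK, Subgraph.coe_adj, Subgraph.deleteVerts_adj, Subgraph.verts_top, Set.mem_univ,
        Subgraph.top_adj, true_and]
      exact ⟨hp, hq, hpq.imp id fun h => ⟨h, he⟩⟩
  have hbound := hH S K.ConnectedComponent
    (fun v => K.connectedComponentMk ⟨⟨v.1, c v⟩, hmem _ (hc v)⟩)
    (fun C => by
      induction C using ConnectedComponent.ind with
      | h p =>
        have hp : p.1 ∉ X := by simpa using p.2
        have hpS : p.1.1 ∉ S := fun h => hp ((Finset.mem_filter.1 h).2 p.1.2)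
        exact ⟨⟨p.1.1, hpS⟩, hcomp _ _ (hc _) hp (Or.inr rfl)⟩)
    (fun a b hab => hcomp _ _ (hc a) (hc b) (Or.inl hab))
  have hodd : K.oddComponents.ncard ≤ Nat.card K.ConnectedComponent := Set.ncard_le_card _
  have hSX : ∑ v ∈ S, h v ≤ X.ncard := by
    have : ∑ v ∈ S, h v = (S.sigma fun v => (Finset.univ : Finset (Fin (h v)))).card := by simp
    rw [this, ← Set.ncard_coe_finset]
    refine Set.ncard_le_ncard (fun p hp => ?_) (Set.toFinite _)
    exact (Finset.mem_filter.1 (Finset.mem_sigma.1 hp).1).2 p.2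
  have hsum : ∑ v ∈ S, ((f v : ℤ) - 1) ≤ ∑ v ∈ S, (h v : ℤ) :=
    Finset.sum_le_sum fun v _ => by have := hfh v; omega
  rw [← Nat.cast_sum] at hsum
  have hcard : Nat.card ((⊤ : (H.blowUp h).Subgraph).deleteVerts X).verts + X.ncard =
      ∑ v, h v := by
    have h1 : ((⊤ : (H.blowUp h).Subgraph).deleteVerts X).verts = Xᶜ := by
      ext; simp
    rw [h1, Nat.card_coe_set_eq, add_comm, Set.ncard_add_ncard_compl]
    simp
  have hpar := odd_ncard_oddComponents (G := K)
  unfold IsTutteViolator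
  rw [← hK, not_lt]
  by_contra! hlt
  have heq : K.oddComponents.ncard = X.ncard + 1 := by omega
  rw [heq, ← Nat.not_even_iff_odd, ← Nat.not_even_iff_odd] at hpar
  have := hcard ▸ heven
  grind

open Classical in
/-- Under the component bound for `f`, there is a multigraph on the edges of `H` whose degrees are at
most `h` and congruent to `h` modulo `2`, whenever `h ≥ f - 1` has even sum. -/
theorem ComponentBound.exists_parity_multigraph {H : SimpleGraph V} {f h : V → ℕ}
    (hH : ComponentBound H f) (hfh : ∀ v, f v ≤ h v + 1) (heven : Even (∑ v, h v)) :
    ∃ j : V → V → ℕ, (∀ a b, j a b = j b a) ∧ (∀ a b, 0 < j a b → H.Adj a b) ∧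
      ∀ v, ∃ k, ∑ w, j v w + 2 * k = h v := by
  obtain ⟨P, hP⟩ := tutte.2 (hH.not_isTutteViolator hfh heven)
  choose σ hσ hσu using fun p => Subgraph.isPerfectMatching_iff.1 hP p
  have hinv : ∀ p, σ (σ p) = p := fun p => (hσu (σ p) p (hσ p).symm).symm
  have hadj : ∀ p, (H.blowUp h).Adj p (σ p) := fun p => (hσ p).adj_sub
  -- The multiplicity of `vw` is the number of copies of `v` matched to copies of `w`. Copies of `v`
  -- matched to each other come in pairs, which preserves the parity of `h v`.
  refine ⟨fun v w => ((Finset.univ : Finset (Σ v, Fin (h v))).filter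
    fun p => p.1 = v ∧ (σ p).1 = w ∧ v ≠ w).card, fun a b => ?_, fun a b hab => ?_, fun v => ?_⟩
  · refine Finset.card_bij (fun p _ => σ p) ?_ ?_ ?_
    · intro p hp
      simp only [Finset.mem_filter, Finset.mem_univ, true_and] at hp ⊢
      exact ⟨hp.2.1, by rw [hinv]; exact hp.1, hp.2.2.symm⟩
    · intro p _ q _ hpq
      rw [← hinv p, ← hinv q, hpq]
    · intro p hp
      simp only [Finset.mem_filter, Finset.mem_univ, true_and] at hp
      refine ⟨σ p, ?_, hinv p⟩
      simp only [Finset.mem_filter, Finset.mem_univ, true_and]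
      exact ⟨hp.2.1, by rw [hinv]; exact hp.1, hp.2.2.symm⟩
  · obtain ⟨p, hp⟩ := Finset.card_pos.1 hab
    simp only [Finset.mem_filter, Finset.mem_univ, true_and] at hp
    obtain ⟨rfl, rfl, hne⟩ := hp
    exact (hadj p).resolve_right fun h => hne h.1
  · have hev : Even ((Finset.univ : Finset (Σ v, Fin (h v))).filter
        fun p => p.1 = v ∧ (σ p).1 = v).card := by
      refine even_card_of_involution (σ := σ) ?_ (fun p _ => hinv p) fun p _ => (hadj p).ne'
      intro p hp
      simp only [Finset.mem_filter, Finset.mem_univ, true_and] at hp ⊢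
      exact ⟨hp.2, by rw [hinv]; exact hp.1⟩
    obtain ⟨k, hk⟩ := hev
    refine ⟨k, ?_⟩
    have h1 : ((Finset.univ : Finset (Σ v, Fin (h v))).filter fun p => p.1 = v).card = h v := by
      have : (Finset.univ : Finset (Σ v, Fin (h v))).filter (fun p => p.1 = v) =
          ({v} : Finset V).sigma fun v => Finset.univ := by
        ext p; simp
      rw [this]; simp
    have h2 := Finset.card_filter_add_card_filter_not
      (s := (Finset.univ : Finset (Σ v, Fin (h v))).filter fun p => p.1 = v) (fun p => (σ p).1 = v)
    rw [Finset.filter_filter, Finset.filter_filter, h1, hk] at h2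
    have h3 : ((Finset.univ : Finset (Σ v, Fin (h v))).filter
        fun p => p.1 = v ∧ ¬(σ p).1 = v).card = ∑ w, ((Finset.univ : Finset (Σ v, Fin (h v))).filter
          fun p => p.1 = v ∧ (σ p).1 = w ∧ v ≠ w).card := by
      rw [Finset.card_eq_sum_card_fiberwise (f := fun p => (σ p).1) (t := Finset.univ)
        (fun _ _ => Finset.mem_coe.2 (Finset.mem_univ _))]
      refine Finset.sum_congr rfl fun w _ => ?_
      rw [Finset.filter_filter]
      congr 1
      ext p
      simp only [Finset.mem_filter, Finset.mem_univ, true_and]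
      constructor
      · rintro ⟨⟨h1, h2⟩, h3⟩
        exact ⟨h1, h3, fun h => h2 (h3.trans h.symm)⟩
      · rintro ⟨h1, h2, h3⟩
        exact ⟨⟨h1, fun h => h3 (h.symm.trans h2)⟩, h2⟩
    beta_reduce
    omega

open Classical in
/-- Under the component bound for `f`, there is a closed walk that covers all vertices and all edges
of a given matching and has at most `2 f v` edge ends at each vertex `v`. -/
theorem ComponentBound.exists_closed_walk [Nonempty V] {H M : SimpleGraph V} {f : V → ℕ}
    (hH : ComponentBound H f) (hf : ∀ v, 0 < f v) (hMH : M ≤ H)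
    (hM : ∀ a b c, M.Adj a b → M.Adj a c → b = c) :
    ∃ (x : V) (p : H.Walk x x), (∀ v, v ∈ p.support) ∧ (∀ a b, M.Adj a b → s(a, b) ∈ p.edges) ∧
      ∀ v, p.support.tail.count v ≤ f v := by
  obtain ⟨T, hMT, hTH, hT, hdeg⟩ := hH.exists_isTree hMH hM
  have hle : ∀ v, T.degree v ≤ 2 * f v := fun v => (hdeg v).trans (by have := hf v; omega)
  -- This `h` is what remains of `2 f v` after the tree; the tree bound `f v + 1` is exactly what
  -- makes it at least `f v - 1`.
  obtain ⟨j, hjs, hja, hjd⟩ := hH.exists_parity_multigraph (h := fun v => 2 * f v - T.degree v)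
    (fun v => by have := hdeg v; omega) (by
      have h1 : ∑ v, (2 * f v - T.degree v) + ∑ v, T.degree v = 2 * ∑ v, f v := by
        rw [← Finset.sum_add_distrib, Finset.mul_sum]
        exact Finset.sum_congr rfl fun v _ => Nat.sub_add_cancel (hle v)
      rw [sum_degrees_eq_twice_card_edges] at h1
      exact ⟨∑ v, f v - T.edgeFinset.card, by omega⟩)
  have hsum : ∀ v, ∑ w, ((if T.Adj v w then 1 else 0) + j v w) = T.degree v + ∑ w, j v w := by
    intro v
    rw [Finset.sum_add_distrib, ← card_neighborFinset_eq_degree, neighborFinset_eq_filter,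
      Finset.card_filter]
  obtain ⟨x, p, hsupp, hcount⟩ := exists_eulerian_closed_walk (H := H)
    (m := fun v w => (if T.Adj v w then 1 else 0) + j v w)
    (fun a b => by simp only [T.adj_comm, hjs a b])
    (fun a b hab => by
      by_cases h : T.Adj a b
      · exact hTH h
      · rw [if_neg h, zero_add] at hab
        exact hja a b hab)
    (fun v => by
      obtain ⟨k, hk⟩ := hjd v
      have := hle v
      rw [hsum v]
      exact ⟨f v - k, by omega⟩)
    (fun s hs hclosed => by
      obtain ⟨a, ha⟩ := hs
      refine Set.eq_univ_of_forall fun b => ?_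
      obtain ⟨q⟩ := hT.connected.preconnected a b
      induction q with
      | nil => exact ha
      | cons hadj _ ih => exact ih (hclosed _ ha _ (by simp [hadj])))
  refine ⟨x, p, hsupp, fun a b hab => ?_, fun v => ?_⟩
  · rw [← List.count_pos_iff, hcount, if_pos (hMT hab)]
    omega
  · have h1 := p.countP_mem_edges v
    rw [countP_mem_eq_sum_count, Finset.sum_congr rfl fun w _ => hcount v w, hsum v] at h1
    obtain ⟨k, hk⟩ := hjd v
    have := hle v
    omega

end

end SimpleGraph

/-! ### Transfer from simple graphs to multigraphs. -/

namespace Graph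

variable {α β : Type*} {G : Graph α β}

/-- The `1` accounts for the walk of length `0`, which meets its vertex once although the tail of
its support is empty. -/
theorem Walk.count_cyclicSupport_le [DecidableEq α] {x y : α} (w : G.Walk x y) (v : α) :
    w.cyclicSupport.count v ≤ max 1 (w.support.tail.count v) := by
  cases w with
  | nil hx =>
    refine le_max_of_le_left ?_
    simpa [cyclicSupport] using List.count_le_length (l := [x]) (a := v)
  | cons e h p => exact le_max_right _ _

/-- The simple graph of adjacency on the vertex set of a loopless graph. -/
def toSimple (G : Graph α β) [G.Loopless] : SimpleGraph G.vertexSet where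
  Adj a b := G.Adj a b
  symm := ⟨fun _ _ h => h.symm⟩
  loopless := ⟨fun _ h => h.ne rfl⟩

/-- The simple graph of the pairs of vertices that are joined by an edge in `M`. -/
def toSimpleOn (G : Graph α β) [G.Loopless] (M : Set β) : SimpleGraph G.vertexSet where
  Adj a b := ∃ e ∈ M, G.IsLink e a b
  symm := ⟨fun _ _ ⟨e, he, h⟩ => ⟨e, he, h.symm⟩⟩
  loopless := ⟨fun _ ⟨_, _, h⟩ => h.adj.ne rfl⟩

/-- The choice `ε` depends on the order of the ends, so an edge may be lifted in either direction.
-/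
theorem exists_walk_of_toSimple [G.Loopless]
    {ε : ∀ a b : G.vertexSet, G.toSimple.Adj a b → β} (hε : ∀ a b h, G.IsLink (ε a b h) a b) {x y : G.vertexSet}
    (p : G.toSimple.Walk x y) :
    ∃ w : G.Walk (x : α) y, w.support = p.support.map Subtype.val ∧
      ∀ a b h, s(a, b) ∈ p.edges → ε a b h ∈ w.edges ∨ ε b a h.symm ∈ w.edges := by
  induction p with
  | nil => exact ⟨Walk.nil (Subtype.property _), rfl, by simp⟩
  | @cons u v z h p ih =>
    obtain ⟨w, h1, h2⟩ := ih
    refine ⟨Walk.cons (ε u v h) (hε _ _ h) w, by simp [Walk.support, h1], fun a b h' hab => ?_⟩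
    simp only [SimpleGraph.Walk.edges_cons, List.mem_cons] at hab
    simp only [Walk.edges, List.mem_cons]
    rcases hab with hab | hab
    · rcases Sym2.eq_iff.1 hab with ⟨rfl, rfl⟩ | ⟨rfl, rfl⟩ <;> simp
    · exact (h2 a b h' hab).imp Or.inr Or.inr

theorem componentBound_toSimple [G.Loopless] [Fintype G.vertexSet] {f : α → ℕ}
    (h : ∀ S : Finset α, (S : Set α) ⊆ G.vertexSet →
      ((G.deleteVerts (S : Set α)).numComponents : ℤ) ≤ ∑ v ∈ S, ((f v : ℤ) - 1) + 1) :
    G.toSimple.ComponentBound fun v => f v := by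
  intro D I φ hφ hadj
  have h1 := h (D.map (Function.Embedding.subtype _)) (by
    intro v hv
    obtain ⟨w, -, rfl⟩ := Finset.mem_map.1 (Finset.mem_coe.1 hv)
    exact w.2)
  rw [Finset.sum_map] at h1
  refine le_trans ?_ h1
  rw [Nat.cast_le]
  set G' := G.deleteVerts ((D.map (Function.Embedding.subtype _) : Finset α) : Set α) with hG'
  have hV : ∀ v, v ∈ G'.vertexSet → ∃ hv : v ∈ G.vertexSet, (⟨v, hv⟩ : G.vertexSet) ∉ D := by
    intro v hv
    rw [hG', vertexSet_deleteVerts] at hv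
    refine ⟨hv.1, fun hD => hv.2 ?_⟩
    exact Finset.mem_coe.2 (Finset.mem_map.2 ⟨_, hD, rfl⟩)
  have hV' : ∀ v : G.vertexSet, v ∉ D → (v : α) ∈ G'.vertexSet := by
    intro v hv
    rw [hG', vertexSet_deleteVerts]
    refine ⟨v.2, fun h => hv ?_⟩
    obtain ⟨w, hw, hwv⟩ := Finset.mem_map.1 (Finset.mem_coe.1 h)
    rwa [← Subtype.ext hwv]
  have : Finite G'.vertexSet :=
    Set.Finite.subset (Set.toFinite G.vertexSet) fun v hv => (hV v hv).1
  let ψ : (Quot fun x y : G'.vertexSet => G'.Adj x y) → I :=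
    Quot.lift (fun v => φ ⟨⟨v.1, (hV v.1 v.2).1⟩, (hV v.1 v.2).2⟩) fun a b hab => by
      refine hadj _ _ ?_
      obtain ⟨e, he⟩ := hab
      exact ⟨e, ((deleteVerts_isLink _ _).1 he).1⟩
  refine Nat.card_le_card_of_surjective ψ fun i => ?_
  obtain ⟨v, rfl⟩ := hφ i
  exact ⟨Quot.mk _ ⟨v.1.1, hV' v.1 v.2⟩, rfl⟩

theorem exists_isFWalk_of_numComponents_le [G.Loopless] (hfin : G.vertexSet.Finite)
    (hne : G.vertexSet.Nonempty) {f : α → ℕ} (hf : ∀ v ∈ G.vertexSet, 0 < f v)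
    (h : ∀ S : Finset α, (S : Set α) ⊆ G.vertexSet →
      ((G.deleteVerts (S : Set α)).numComponents : ℤ) ≤ ∑ v ∈ S, ((f v : ℤ) - 1) + 1)
    {M : Set β} (hM : G.IsEdgeMatching M) :
    ∃ (x : α) (w : G.Walk x x), w.IsFWalk f ∧ ∀ e ∈ M, e ∈ w.edges := by
  classical
  have := hfin.fintype
  have := hne.to_subtype
  obtain ⟨x, p, hsupp, hedge, hcount⟩ := (componentBound_toSimple h).exists_closed_walk
    (M := G.toSimpleOn M) (fun v => hf v v.2) (fun a b ⟨e, _, h⟩ => ⟨e, h⟩)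
    (fun a b c ⟨e, he, h⟩ ⟨e', he', h'⟩ => by
      obtain rfl := hM.eq_of_inc e he e' he' a h.inc_left h'.inc_left
      exact Subtype.ext (h.right_unique h'))
  -- Among parallel edges the one in `M`, if any, is chosen; it is unique because `M` is a matching.
  have hε : ∀ a b : G.vertexSet, G.toSimple.Adj a b →
      ∃ e, G.IsLink e a b ∧ ∀ e' ∈ M, G.IsLink e' a b → e' = e := by
    intro a b hab
    by_cases hMab : ∃ e ∈ M, G.IsLink e a b
    · obtain ⟨e, he, hl⟩ := hMab
      exact ⟨e, hl, fun e' he' hl' => hM.eq_of_inc e' he' e he a hl'.inc_left hl.inc_left⟩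
    · obtain ⟨e, hl⟩ := hab
      exact ⟨e, hl, fun e' he' hl' => absurd ⟨e', he', hl'⟩ hMab⟩
  choose ε hε hεM using hε
  obtain ⟨w, hw, hwe⟩ := exists_walk_of_toSimple hε p
  refine ⟨x, w, ⟨fun v hv => ?_, fun v hv => ?_⟩, fun e he => ?_⟩
  · rw [hw]
    exact List.mem_map.2 ⟨⟨v, hv⟩, hsupp _, rfl⟩
  · refine le_trans (le_of_eq ?_) ((w.count_cyclicSupport_le v).trans (max_le (hf v hv) ?_))
    · unfold Walk.meetCount
      congr!
    · rw [hw, ← List.map_tail]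
      refine (List.count_map_of_injective _ _ Subtype.val_injective ⟨v, hv⟩).trans_le ?_
      convert hcount ⟨v, hv⟩
  · obtain ⟨a, b, hab⟩ := (G.edge_mem_iff_exists_isLink e).1 (hM.subset he)
    have h1 : G.toSimple.Adj ⟨a, hab.left_mem⟩ ⟨b, hab.right_mem⟩ := ⟨e, hab⟩
    rcases hwe _ _ h1 (hedge ⟨a, hab.left_mem⟩ ⟨b, hab.right_mem⟩ ⟨e, he, hab⟩) with h2 | h2
    · rwa [hεM _ _ h1 e he hab]
    · rwa [hεM _ _ h1.symm e he hab.symm]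

end Graph

theorem mainTheorem2 {α β : Type*} (G : Graph α β) [G.Loopless]
    (hfin : G.vertexSet.Finite) (hne : G.vertexSet.Nonempty) :
    (∀ f : α → ℕ, (∀ v ∈ G.vertexSet, 0 < f v) →
      (∀ S : Finset α, (S : Set α) ⊆ G.vertexSet →
        ((G.deleteVerts (S : Set α)).numComponents : ℤ) ≤ ∑ v ∈ S, ((f v : ℤ) - 1) + 1) →
      ∀ M : Set β, G.IsEdgeMatching M →
        ∃ (x : α) (w : G.Walk x x), w.IsFWalk f ∧ ∀ e ∈ M, e ∈ w.edges) ∧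
    (∀ n : ℕ, 2 ≤ n → G.IsTough (1 / ((n : ℝ) - 1)) →
      ∃ (x : α) (w : G.Walk x x), w.IsFWalk (fun _ => n)) := by
  refine ⟨fun f hf h M hM => Graph.exists_isFWalk_of_numComponents_le hfin hne hf h hM,
    fun n hn ht => ?_⟩
  have hbound : ∀ S : Finset α, (S : Set α) ⊆ G.vertexSet →
      ((G.deleteVerts (S : Set α)).numComponents : ℤ) ≤ ∑ v ∈ S, ((n : ℤ) - 1) + 1 := by
    intro S hS
    have h1 := ht S hS
    have h2 : (0 : ℝ) ≤ (n : ℝ) - 1 := by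
      have : (2 : ℝ) ≤ n := by exact_mod_cast hn
      linarith
    have h3 : (0 : ℝ) ≤ S.card * ((n : ℝ) - 1) := by positivity
    rw [one_div_one_div] at h1
    -- Both terms of the maximum are nonnegative, so it is at most their sum.
    have h4 : ((G.deleteVerts (S : Set α)).numComponents : ℝ) ≤ S.card * ((n : ℝ) - 1) + 1 :=
      h1.trans (max_le (by linarith) (by linarith))
    rw [Finset.sum_const, nsmul_eq_mul]
    exact_mod_cast h4
  obtain ⟨x, w, hw, -⟩ := Graph.exists_isFWalk_of_numComponents_le (G := G) (f := fun _ => n)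
    (M := ∅) hfin hne (fun _ _ => by omega) hbound ⟨by simp, by simp⟩
  exact ⟨x, w, hw⟩
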